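/- Let $k:\mathbb{R}^{n_x}\times\mathbb{R}^{n_x}\to\mathbb{R}^{n_f\times n_f}$ be a positive-semidefinite matrix-valued kernel with reproducing kernel Hilbert space $\mathcal{H}_k$ of functions $\mathbb{R}^{n_x}\to\mathbb{R}^{n_f}$. Let $f^{\mathrm{tr}}\in\mathcal{H}_k$ with $\|f^{\mathrm{tr}}\|_{\mathcal{H}_k}<\Gamma_f$, $\Gamma_f>0$. Let data $y\in\mathbb{R}^N$ be given by $y_i=c_i^\top f^{\mathrm{tr}}(x_i)+w_i$, $i=1,\dots,N$, with known $x_i\in\mathbb{R}^{n_x}$, $c_i\in\mathbb{R}^{n_f}$, and noise $w\in\mathbb{R}^N$ satisfying $w^\top P^w_j w<\Gamma_{w,j}^2$ for $j=1,\dots,n_{\mathrm{con}}$, where $\Gamma_{w,j}>0$, each $P^w_j\in\mathbb{R}^{N\times N}$ is positive semidefinite and $\sum_j P^w_j$ is positive definite. For block matrices $K^f_{I,J}=[k(x_i,x_j)]_{i\in I,j\in J}$, $C^\top=\mathrm{blkdiag}(c_1^\top,\dots,c_N^\top)$, a test point $x_{N+1}\in\mathbb{R}^{n_x}$ and $\sigma\in\mathbb{R}_{>0}^{n_{\mathrm{con}}}$,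 put $$P^w_\sigma=\sum_{j}\sigma_j^{-2}P^w_j,\qquad \hat K_\sigma=C^\top K^f_{1:N,1:N}C+(P^w_\sigma)^{-1},\qquad \mu_\sigma=K^f_{N+1,1:N}C\hat K_\sigma^{-1}y,$$ $$\Sigma_\sigma=K^f_{N+1,N+1}-K^f_{N+1,1:N}C\hat K_\sigma^{-1}C^\top K^f_{1:N,N+1},\qquad \beta_\sigma=\sqrt{\Gamma_f^2+\sum_{j}\frac{\Gamma_{w,j}^2}{\sigma_j^2}-y^\top\hat K_\sigma^{-1}y},$$ and, for $h\in\mathbb{R}^{n_f}$, $\overline f_h^\sigma(x_{N+1})=h^\top\mu_\sigma+\beta_\sigma\sqrt{h^\top\Sigma_\sigma h}$. Let $\overline f_h(x_{N+1})$ be the supremum of $h^\top f(x_{N+1})$ over all $f\in\mathcal{H}_k$, $w'\in\mathbb{R}^N$ with $c_i^\top f(x_i)+w'_i=y_i$ for all $i$, $w'^\top P^w_jw'\le\Gamma_{w,j}^2$ for all $j$, and $\|f\|_{\mathcal{H}_k}^2\le\Gamma_f^2$. Then, for every $h\in\mathbb{R}^{n_f}$ and $x_{N+1}\in\mathbb{R}^{n_x}$,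 for all $\sigma\in\mathbb{R}_{>0}^{n_{\mathrm{con}}}$ the matrices $P^w_\sigma$ and $\hat K_\sigma$ are positive definite and both radicands are nonnegative, and: (i) $h^\top f^{\mathrm{tr}}(x_{N+1})\le\overline f_h^\sigma(x_{N+1})$ for all $\sigma\in\mathbb{R}_{>0}^{n_{\mathrm{con}}}$; (ii) $\overline f_h(x_{N+1})=\inf_{\sigma\in\mathbb{R}_{>0}^{n_{\mathrm{con}}}}\overline f_h^\sigma(x_{N+1})$, where the supremum and the infimum are finite; (iii) $\sigma\mapsto\overline f_h^\sigma(x_{N+1})$ is differentiable on $\mathbb{R}_{>0}^{n_{\mathrm{con}}}$ and invex: $\sigma^\star\in\mathbb{R}_{>0}^{n_{\mathrm{con}}}$ is a global minimizer of $\overline f_h^\sigma(x_{N+1})$ over $\mathbb{R}_{>0}^{n_{\mathrm{con}}}$ if and only if $\frac{\partial}{\partial\sigma}\overline f_h^\sigma(x_{N+1})\big|_{\sigma=\sigma^\star}=0$. -/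

import Mathlib

open Matrix

noncomputable section

namespace KernelBound

/-- `H` is the reproducing kernel Hilbert space of the matrix-valued kernel `k`: a Hilbert space of
functions `ℝ^nx → ℝ^nf` with continuous point evaluations whose reproducing kernel is `k`
(so `k` is automatically positive semidefinite, and every positive semidefinite `k` has such
an `H`, namely `RKHS.OfKernel`). -/
def IsRKHSOf {nx nf : ℕ} (H : Type*) [NormedAddCommGroup H] [InnerProductSpace ℝ H]
    [CompleteSpace H] [RKHS ℝ H (EuclideanSpace ℝ (Fin nx)) (EuclideanSpace ℝ (Fin nf))]
    (k : EuclideanSpace ℝ (Fin nx) → EuclideanSpace ℝ (Fin nx) → Matrix (Fin nf) (Fin nf) ℝ) :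
    Prop :=
  ∀ s t, RKHS.kernel H s t = Matrix.toEuclideanCLM (n := Fin nf) (𝕜 := ℝ) (k s t)

variable {nx nf N ncon : ℕ}

/-- The block matrix `K^f_{1:N,1:N} = [k(x_i, x_j)]`. -/
def gramTrain (k : EuclideanSpace ℝ (Fin nx) → EuclideanSpace ℝ (Fin nx) →
    Matrix (Fin nf) (Fin nf) ℝ) (x : Fin N → EuclideanSpace ℝ (Fin nx)) :
    Matrix (Fin N × Fin nf) (Fin N × Fin nf) ℝ :=
  Matrix.of fun p q => k (x p.1) (x q.1) p.2 q.2

/-- The block row `K^f_{N+1,1:N} = [k(x_{N+1}, x_j)]`, with `xt` the test point `x_{N+1}`. -/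
def gramTestTrain (k : EuclideanSpace ℝ (Fin nx) → EuclideanSpace ℝ (Fin nx) →
    Matrix (Fin nf) (Fin nf) ℝ) (x : Fin N → EuclideanSpace ℝ (Fin nx))
    (xt : EuclideanSpace ℝ (Fin nx)) : Matrix (Fin nf) (Fin N × Fin nf) ℝ :=
  Matrix.of fun a q => k xt (x q.1) a q.2

/-- The block column `K^f_{1:N,N+1} = [k(x_i, x_{N+1})]`. -/
def gramTrainTest (k : EuclideanSpace ℝ (Fin nx) → EuclideanSpace ℝ (Fin nx) →
    Matrix (Fin nf) (Fin nf) ℝ) (x : Fin N → EuclideanSpace ℝ (Fin nx))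
    (xt : EuclideanSpace ℝ (Fin nx)) : Matrix (Fin N × Fin nf) (Fin nf) ℝ :=
  Matrix.of fun p b => k (x p.1) xt p.2 b

/-- The measurement matrix `C`, where `Cᵀ = blkdiag(c_1ᵀ, …, c_Nᵀ)`. -/
def measMatrix (c : Fin N → Fin nf → ℝ) : Matrix (Fin N × Fin nf) (Fin N) ℝ :=
  Matrix.of fun p j => if p.1 = j then c p.1 p.2 else 0

/-- `P^w_σ = ∑ j, σ_j⁻² P^w_j`. -/
def noisePrecision (P : Fin ncon → Matrix (Fin N) (Fin N) ℝ) (σ : Fin ncon → ℝ) :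
    Matrix (Fin N) (Fin N) ℝ :=
  ∑ j, (σ j ^ 2)⁻¹ • P j

/-- `K̂_σ = Cᵀ K^f_{1:N,1:N} C + K^w_σ`, where `K^w_σ = (P^w_σ)⁻¹`. -/
def gramHat (k : EuclideanSpace ℝ (Fin nx) → EuclideanSpace ℝ (Fin nx) →
    Matrix (Fin nf) (Fin nf) ℝ) (x : Fin N → EuclideanSpace ℝ (Fin nx))
    (c : Fin N → Fin nf → ℝ) (P : Fin ncon → Matrix (Fin N) (Fin N) ℝ) (σ : Fin ncon → ℝ) :
    Matrix (Fin N) (Fin N) ℝ :=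
  (measMatrix c)ᵀ * gramTrain k x * measMatrix c + (noisePrecision P σ)⁻¹

/-- The posterior mean `μ_σ(x_{N+1}) = K^f_{N+1,1:N} C K̂_σ⁻¹ y`. -/
def postMean (k : EuclideanSpace ℝ (Fin nx) → EuclideanSpace ℝ (Fin nx) →
    Matrix (Fin nf) (Fin nf) ℝ) (x : Fin N → EuclideanSpace ℝ (Fin nx))
    (c : Fin N → Fin nf → ℝ) (y : Fin N → ℝ) (P : Fin ncon → Matrix (Fin N) (Fin N) ℝ)
    (xt : EuclideanSpace ℝ (Fin nx)) (σ : Fin ncon → ℝ) : Fin nf → ℝ :=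
  (gramTestTrain k x xt * measMatrix c * (gramHat k x c P σ)⁻¹) *ᵥ y

/-- The posterior covariance
`Σ_σ(x_{N+1}) = K^f_{N+1,N+1} - K^f_{N+1,1:N} C K̂_σ⁻¹ Cᵀ K^f_{1:N,N+1}`. -/
def postCov (k : EuclideanSpace ℝ (Fin nx) → EuclideanSpace ℝ (Fin nx) →
    Matrix (Fin nf) (Fin nf) ℝ) (x : Fin N → EuclideanSpace ℝ (Fin nx))
    (c : Fin N → Fin nf → ℝ) (P : Fin ncon → Matrix (Fin N) (Fin N) ℝ)
    (xt : EuclideanSpace ℝ (Fin nx)) (σ : Fin ncon → ℝ) : Matrix (Fin nf) (Fin nf) ℝ :=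
  k xt xt -
    gramTestTrain k x xt * measMatrix c * (gramHat k x c P σ)⁻¹ * (measMatrix c)ᵀ *
      gramTrainTest k x xt

/-- `β_σ² = Γ_f² + ∑ j, Γ_{w,j}² / σ_j² - ‖y‖²_{K̂_σ⁻¹}`. -/
def betaSq (k : EuclideanSpace ℝ (Fin nx) → EuclideanSpace ℝ (Fin nx) →
    Matrix (Fin nf) (Fin nf) ℝ) (x : Fin N → EuclideanSpace ℝ (Fin nx))
    (c : Fin N → Fin nf → ℝ) (y : Fin N → ℝ) (P : Fin ncon → Matrix (Fin N) (Fin N) ℝ)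
    (Γf : ℝ) (Γw : Fin ncon → ℝ) (σ : Fin ncon → ℝ) : ℝ :=
  Γf ^ 2 + ∑ j, Γw j ^ 2 / σ j ^ 2 - y ⬝ᵥ ((gramHat k x c P σ)⁻¹ *ᵥ y)

/-- The bound `hᵀ μ_σ(x_{N+1}) + β_σ √(hᵀ Σ_σ(x_{N+1}) h)`. -/
def gpBound (k : EuclideanSpace ℝ (Fin nx) → EuclideanSpace ℝ (Fin nx) →
    Matrix (Fin nf) (Fin nf) ℝ) (x : Fin N → EuclideanSpace ℝ (Fin nx))
    (c : Fin N → Fin nf → ℝ) (y : Fin N → ℝ) (P : Fin ncon → Matrix (Fin N) (Fin N) ℝ)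
    (Γf : ℝ) (Γw : Fin ncon → ℝ) (h : Fin nf → ℝ) (xt : EuclideanSpace ℝ (Fin nx))
    (σ : Fin ncon → ℝ) : ℝ :=
  h ⬝ᵥ postMean k x c y P xt σ +
    √(betaSq k x c y P Γf Γw σ) * √(h ⬝ᵥ (postCov k x c P xt σ *ᵥ h))

/-- The values `hᵀ f(x_{N+1})` of the objective at the feasible points `(f, w)` of the worst-case
problem. -/
def feasibleValues (H : Type*) [NormedAddCommGroup H] [InnerProductSpace ℝ H]
    [RKHS ℝ H (EuclideanSpace ℝ (Fin nx)) (EuclideanSpace ℝ (Fin nf))]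
    (x : Fin N → EuclideanSpace ℝ (Fin nx))
    (c : Fin N → Fin nf → ℝ) (y : Fin N → ℝ) (P : Fin ncon → Matrix (Fin N) (Fin N) ℝ)
    (Γf : ℝ) (Γw : Fin ncon → ℝ) (h : Fin nf → ℝ) (xt : EuclideanSpace ℝ (Fin nx)) : Set ℝ :=
  {v | ∃ (f : H) (w : Fin N → ℝ),
    (∀ i, c i ⬝ᵥ (f (x i)).ofLp + w i = y i) ∧
    (∀ j, w ⬝ᵥ (P j *ᵥ w) ≤ Γw j ^ 2) ∧
    ‖f‖ ^ 2 ≤ Γf ^ 2 ∧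
    v = h ⬝ᵥ (f xt).ofLp}

/-- The optimal worst-case bound: the supremum of `hᵀ f(x_{N+1})` over all feasible `(f, w)`. -/
def optimalBound (H : Type*) [NormedAddCommGroup H] [InnerProductSpace ℝ H]
    [RKHS ℝ H (EuclideanSpace ℝ (Fin nx)) (EuclideanSpace ℝ (Fin nf))]
    (x : Fin N → EuclideanSpace ℝ (Fin nx))
    (c : Fin N → Fin nf → ℝ) (y : Fin N → ℝ) (P : Fin ncon → Matrix (Fin N) (Fin N) ℝ)
    (Γf : ℝ) (Γw : Fin ncon → ℝ) (h : Fin nf → ℝ) (xt : EuclideanSpace ℝ (Fin nx)) : ℝ :=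
  sSup (feasibleValues H x c y P Γf Γw h xt)

/-- The open positive orthant `ℝ_{>0}^ncon` of noise parameters. -/
def posOrthant (ncon : ℕ) : Set (Fin ncon → ℝ) := {σ | ∀ j, 0 < σ j}

end KernelBound

end

/-!
Each functional involved is represented by an element of the Hilbert space `H`: `u i` represents
`f ↦ c_iᵀ f(x_i)` and `g` represents `f ↦ hᵀ f(x_{N+1})`. Eliminating the noise, the worst-case
problem is to maximize `⟨g, f⟩` subject to the norm constraint and the noise constraints on the
residual `y - (⟨u i, f⟩)_i`. Adding the constraints with weights `1` and `σ_j⁻²` gives one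
ellipsoid that contains the feasible set, and the bound at `σ` is exactly the maximum of
`⟨g, ·⟩` over this ellipsoid (`ellipsoidSup`). This follows by completing the square
(`energy_center_add`): the posterior mean is the value at the center, `β_σ²` is the squared radius,
and `hᵀ Σ_σ h` is the squared dual norm of `g`. So every bound is at least the worst-case value, and
`β_σ² > 0` because the true function is strictly feasible.

The worst-case value is the infimum of these bounds by Lagrange duality. The strictly feasible
true function is a Slater point, so there are nonnegative multipliers with no duality gap
(`exists_lagrange_multipliers`). After a small shift that makes them positive, their ratios are the
weights `σ_j⁻²` of an ellipsoid whose bound is nearly optimal (`exists_relaxedBound_le`).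

For invexity, let `σ` be stationary and let `f` be the maximizer over its ellipsoid. The
Lagrangian at `f`, with the multiplier of the ellipsoid of each `τ`, is a lower bound of the bound
at `τ` that is attained at `τ = σ`. Comparing derivatives there shows that all noise constraints
are tight at `f`, and hence so is the norm constraint. So `f` is feasible and the bound at `σ` is
the worst-case value, which is minimal (`relaxedBound_le_of_fderiv_eq_zero`). The bound is
differentiable because `hᵀ Σ_σ h > 0` unless `g = 0`, when the bound is identically zero.
-/

namespace KernelBound

/-! ### Lagrange multipliers under Slater's condition -/

/-- Strong Lagrangian duality for a concave objective `φ` and finitely many convex constraints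
`q i ≤ 0` that hold strictly at some point: every upper bound `p` of the constrained problem is an
upper bound of the unconstrained Lagrangian, for suitable multipliers. -/
theorem exists_lagrange_multipliers {E ι : Type*} [AddCommGroup E] [Module ℝ E] [Fintype ι]
    {φ : E → ℝ} (hφ : ConcaveOn ℝ Set.univ φ) {q : ι → E → ℝ}
    (hq : ∀ i, ConvexOn ℝ Set.univ (q i)) {f₀ : E} (hf₀ : ∀ i, q i f₀ < 0) {p : ℝ}
    (hp : ∀ f, (∀ i, q i f ≤ 0) → φ f ≤ p) :
    ∃ m : ι → ℝ, (∀ i, 0 ≤ m i) ∧ ∀ f, φ f - ∑ i, m i * q i f ≤ p := by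
  classical
  -- The open convex set of objective gains and slacks that can be strictly beaten; it misses `0`.
  set S : Set (ℝ × (ι → ℝ)) := {z | ∃ f, z.1 < φ f - p ∧ ∀ i, z.2 i < -q i f} with hS
  have hconv : Convex ℝ S := by
    rintro z ⟨f, hf, hf'⟩ z' ⟨f', hz, hz'⟩ a b ha hb hab
    refine ⟨a • f + b • f', ?_, fun i => ?_⟩
    · have h1 := hφ.2 (Set.mem_univ f) (Set.mem_univ f') ha hb hab
      simp only [smul_eq_mul, Prod.fst_add, Prod.smul_fst] at h1 ⊢
      obtain rfl : b = 1 - a := by linarith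
      rcases ha.eq_or_lt with rfl | ha
      · nlinarith
      · nlinarith
    · have h1 := (hq i).2 (Set.mem_univ f) (Set.mem_univ f') ha hb hab
      have := hf' i
      have := hz' i
      simp only [smul_eq_mul, Prod.snd_add, Prod.smul_snd, Pi.add_apply, Pi.smul_apply] at h1 ⊢
      obtain rfl : b = 1 - a := by linarith
      rcases ha.eq_or_lt with rfl | ha
      · nlinarith
      · nlinarith
  have hopen : IsOpen S := by
    have : S = ⋃ f, {z : ℝ × (ι → ℝ) | z.1 < φ f - p} ∩ ⋂ i, {z | z.2 i < -q i f} := by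
      ext z
      simp [hS]
    rw [this]
    refine isOpen_iUnion fun f => (isOpen_lt (by fun_prop) (by fun_prop)).inter ?_
    exact isOpen_iInter_of_finite fun i => isOpen_lt (by fun_prop) (by fun_prop)
  have h0 : (0 : ℝ × (ι → ℝ)) ∉ S := by
    rintro ⟨f, h1, h2⟩
    have := hp f fun i => by have := h2 i; simp at this; exact this.le
    simp at h1
    linarith
  obtain ⟨L, hL⟩ := geometric_hahn_banach_open_point hconv hopen h0
  rw [map_zero] at hL
  set a := L (1, 0)
  set b : ι → ℝ := fun i => L (0, Pi.single i 1) with hb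
  have hLapp : ∀ z, L z = z.1 * a + ∑ i, z.2 i * b i := by
    intro z
    have : z = z.1 • ((1, 0) : ℝ × (ι → ℝ)) +
        ∑ i, z.2 i • ((0, Pi.single i 1) : ℝ × (ι → ℝ)) := by
      refine Prod.ext ?_ ?_
      · simp [Prod.fst_sum]
      · ext j
        simp [Prod.snd_sum, Pi.single_apply]
    conv_lhs => rw [this]
    simp only [map_add, map_sum, map_smul, smul_eq_mul, a, hb]
  -- `L` is nonpositive on the closure of `S`.
  have hle : ∀ f (s : ℝ) (v : ι → ℝ), s ≤ φ f - p → (∀ i, v i ≤ -q i f) →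
      s * a + ∑ i, v i * b i ≤ 0 := by
    intro f s v hs hv
    have key : ∀ ε > 0, s * a + ∑ i, v i * b i - ε * (a + ∑ i, b i) ≤ 0 := by
      intro ε hε
      have := (hL (s - ε, fun i => v i - ε)
        ⟨f, by simp only; linarith, fun i => by have := hv i; simp only; linarith⟩).le
      rw [hLapp] at this
      simp only [sub_mul, Finset.sum_sub_distrib, ← Finset.mul_sum] at this
      linarith
    have ht : Filter.Tendsto
        (fun ε : ℝ => s * a + ∑ i, v i * b i - ε * (a + ∑ i, b i)) (nhdsWithin 0 (Set.Ioi 0))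
        (nhds (s * a + ∑ i, v i * b i - 0 * (a + ∑ i, b i))) :=
      Filter.Tendsto.mono_left (Continuous.tendsto (by fun_prop) 0) nhdsWithin_le_nhds
    have := le_of_tendsto ht (Filter.eventually_of_mem self_mem_nhdsWithin fun ε hε => key ε hε)
    simpa using this
  -- `S` is downward closed, so the coefficients of `L` are nonnegative.
  have ha0 : 0 ≤ a := by
    by_contra! hneg
    set T := ∑ i, -q i f₀ * b i
    have h1 := hle f₀ (φ f₀ - p - (|(φ f₀ - p) * a + T| + 1) / (-a)) (fun i => -q i f₀)
      (by
        have : 0 ≤ (|(φ f₀ - p) * a + T| + 1) / (-a) := by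
          have : 0 < -a := by linarith
          positivity
        linarith) (fun i => le_rfl)
    rw [sub_mul, div_mul_eq_mul_div, mul_div_assoc, div_neg, div_self hneg.ne] at h1
    have := neg_abs_le ((φ f₀ - p) * a + T)
    linarith
  have hb0 : ∀ i, 0 ≤ b i := by
    intro j
    by_contra! hneg
    set T := (φ f₀ - p) * a + ∑ i, -q i f₀ * b i
    have h1 := hle f₀ (φ f₀ - p)
      (fun i => -q i f₀ - (Pi.single j ((|T| + 1) / (-b j)) : ι → ℝ) i) le_rfl
      (by
        have : 0 ≤ (|T| + 1) / (-b j) := by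
          have : 0 < -b j := by linarith
          positivity
        intro i
        have : 0 ≤ (Pi.single j ((|T| + 1) / (-b j)) : ι → ℝ) i := by
          by_cases hij : i = j
          · subst hij; simpa using this
          · simp [hij]
        linarith)
    simp only [sub_mul, Finset.sum_sub_distrib, Pi.single_apply, ite_mul, zero_mul,
      Finset.sum_ite_eq', Finset.mem_univ, if_true] at h1
    rw [div_mul_eq_mul_div, mul_div_assoc, div_neg, div_self hneg.ne] at h1
    have := neg_abs_le T
    have hT : T = φ f₀ * a - p * a + ∑ i, -q i f₀ * b i := by simp only [T]; ring
    linarith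
  -- Slater's point excludes `a = 0`.
  have ha : 0 < a := by
    refine lt_of_le_of_ne ha0 fun ha => ?_
    have h1 := hL (φ f₀ - p - 1, fun i => -q i f₀ / 2)
      ⟨f₀, by simp only; linarith, fun i => by have := hf₀ i; simp only; linarith⟩
    rw [hLapp, ← ha] at h1
    have : 0 ≤ ∑ i, -q i f₀ / 2 * b i := Finset.sum_nonneg fun i _ =>
      mul_nonneg (by have := hf₀ i; linarith) (hb0 i)
    simp only [mul_zero, zero_add] at h1
    linarith
  refine ⟨fun i => b i / a, fun i => div_nonneg (hb0 i) ha0, fun f => ?_⟩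
  have h1 := hle f _ (fun i => -q i f) le_rfl (fun i => le_rfl)
  have h2 : ∑ i, b i / a * q i f = -(∑ i, -q i f * b i) / a := by
    rw [← Finset.sum_neg_distrib, Finset.sum_div]
    exact Finset.sum_congr rfl fun i _ => by ring
  rw [h2, neg_div, sub_neg_eq_add]
  have h3 : φ f - p + (∑ i, -q i f * b i) / a ≤ 0 := by
    have := div_nonpos_of_nonpos_of_nonneg h1 ha0
    rwa [add_div, mul_div_cancel_right₀ _ ha.ne'] at this
  linarith

/-! ### Differentiability of the matrix inverse -/

theorem differentiableAt_matrix_det {E n : Type*} [NormedAddCommGroup E] [NormedSpace ℝ E]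
    [Fintype n] [DecidableEq n] {A : E → Matrix n n ℝ} {e : E}
    (hA : ∀ i j, DifferentiableAt ℝ (fun z => A z i j) e) :
    DifferentiableAt ℝ (fun z => (A z).det) e := by
  simp only [Matrix.det_apply]
  refine DifferentiableAt.fun_sum fun s _ => ?_
  exact (HasFDerivAt.finsetProd fun i _ => (hA _ _).hasFDerivAt).differentiableAt.const_smul _

/-- Entries of the inverse are differentiable by Cramer's rule; working entrywise avoids choosing
a norm on matrices. -/
theorem differentiableAt_matrix_inv {E n : Type*} [NormedAddCommGroup E] [NormedSpace ℝ E]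
    [Fintype n] [DecidableEq n] {A : E → Matrix n n ℝ} {e : E}
    (hA : ∀ i j, DifferentiableAt ℝ (fun z => A z i j) e) (hdet : (A e).det ≠ 0) (i j : n) :
    DifferentiableAt ℝ (fun z => (A z)⁻¹ i j) e := by
  simp only [Matrix.inv_def, Matrix.smul_apply, Ring.inverse_eq_inv', Matrix.adjugate_apply,
    smul_eq_mul]
  refine ((differentiableAt_matrix_det hA).inv hdet).mul (differentiableAt_matrix_det fun k l => ?_)
  by_cases hk : k = j
  · subst hk
    simp
  · simpa [Matrix.updateRow_ne hk] using hA k l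

theorem differentiableAt_dotProduct_mulVec {E n : Type*} [NormedAddCommGroup E] [NormedSpace ℝ E]
    [Fintype n] {A : E → Matrix n n ℝ} {e : E}
    (hA : ∀ i j, DifferentiableAt ℝ (fun z => A z i j) e) (v w : n → ℝ) :
    DifferentiableAt ℝ (fun z => v ⬝ᵥ (A z *ᵥ w)) e := by
  simp only [dotProduct, mulVec]
  exact DifferentiableAt.fun_sum fun i _ => (DifferentiableAt.fun_sum fun j _ =>
    (hA i j).mul_const _).const_mul _

/-! ### Regularized least squares in a Hilbert space -/

section Regression

variable {H ι : Type*} [NormedAddCommGroup H] [InnerProductSpace ℝ H]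

/-- The noiseless measurements `⟨u i, f⟩` of `f`, where `u i` represents the `i`-th measurement
functional. -/
noncomputable def measurement (u : ι → H) (f : H) : ι → ℝ := fun i => inner ℝ (u i) f

theorem measurement_add (u : ι → H) (f d : H) : measurement u (f + d) = measurement u f + measurement u d := by
  ext i; simp [measurement, inner_add_right]

theorem measurement_sub (u : ι → H) (f d : H) : measurement u (f - d) = measurement u f - measurement u d := by
  ext i; simp [measurement, inner_sub_right]

theorem measurement_smul (u : ι → H) (t : ℝ) (d : H) : measurement u (t • d) = t • measurement u d := by
  ext i; simp [measurement, inner_smul_right]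

theorem measurement_zero (u : ι → H) : measurement u 0 = 0 := by
  ext i; simp [measurement]

variable [Fintype ι]

/-- The adjoint of `measurement u`. -/
noncomputable def synth (u : ι → H) (v : ι → ℝ) : H := ∑ i, v i • u i

theorem inner_synth (u : ι → H) (v : ι → ℝ) (f : H) :
    inner ℝ (synth u v) f = v ⬝ᵥ measurement u f := by
  simp [synth, measurement, sum_inner, inner_smul_left, dotProduct]

theorem measurement_synth (u : ι → H) (v : ι → ℝ) :
    measurement u (synth u v) = gram ℝ u *ᵥ v := by
  ext i
  simp [synth, measurement, inner_sum, inner_smul_right, mulVec, dotProduct, gram_apply, mul_comm]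

/-- The inner product of `H` perturbed by the noise precision `W` of the measurements. -/
noncomputable def energyForm (u : ι → H) (W : Matrix ι ι ℝ) (d e : H) : ℝ :=
  inner ℝ d e + measurement u d ⬝ᵥ (W *ᵥ measurement u e)

/-- The regularized least squares cost of `f` for the data `y`. -/
noncomputable def energy (u : ι → H) (y : ι → ℝ) (W : Matrix ι ι ℝ) (f : H) : ℝ :=
  ‖f‖ ^ 2 + (y - measurement u f) ⬝ᵥ (W *ᵥ (y - measurement u f))

theorem dotProduct_mulVec_symm {W : Matrix ι ι ℝ} (hW : W.IsHermitian) (v w : ι → ℝ) :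
    v ⬝ᵥ (W *ᵥ w) = w ⬝ᵥ (W *ᵥ v) := by
  have hT : Wᵀ = W := by simpa [conjTranspose_eq_transpose_of_trivial] using hW.eq
  rw [dotProduct_mulVec, ← mulVec_transpose, hT, dotProduct_comm]

theorem norm_sq_le_energyForm_self (u : ι → H) {W : Matrix ι ι ℝ} (hW : W.PosSemidef) (d : H) :
    ‖d‖ ^ 2 ≤ energyForm u W d d := by
  have := hW.dotProduct_mulVec_nonneg (measurement u d)
  simp only [star_trivial] at this
  rw [energyForm, real_inner_self_eq_norm_sq]
  linarith

theorem energyForm_comm (u : ι → H) {W : Matrix ι ι ℝ} (hW : W.IsHermitian) (d e : H) :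
    energyForm u W d e = energyForm u W e d := by
  rw [energyForm, energyForm, real_inner_comm, dotProduct_mulVec_symm hW]

theorem energyForm_sub_smul_self (u : ι → H) {W : Matrix ι ι ℝ} (hW : W.IsHermitian) (d e : H)
    (t : ℝ) : energyForm u W (d - t • e) (d - t • e) =
      energyForm u W d d - 2 * t * energyForm u W d e + t ^ 2 * energyForm u W e e := by
  have := energyForm_comm u hW e d
  have h : energyForm u W (d - t • e) (d - t • e) = energyForm u W d d - t * energyForm u W d e
      - t * energyForm u W e d + t ^ 2 * energyForm u W e e := by
    simp only [energyForm, measurement_sub, measurement_smul, mulVec_sub, mulVec_smul, dotProduct_sub,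
      sub_dotProduct, dotProduct_smul, smul_dotProduct, inner_sub_left, inner_sub_right,
      inner_smul_left, inner_smul_right, smul_eq_mul, conj_trivial]
    ring
  rw [h, this]
  ring

theorem energy_add (u : ι → H) (y : ι → ℝ) {W : Matrix ι ι ℝ} (hW : W.IsHermitian) (f d : H) :
    energy u y W (f + d) = energy u y W f + energyForm u W d d
      + 2 * (inner ℝ f d - measurement u d ⬝ᵥ (W *ᵥ (y - measurement u f))) := by
  have h1 : y - measurement u (f + d) = (y - measurement u f) - measurement u d := by
    rw [measurement_add]; abel
  simp only [energy, energyForm, h1]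
  generalize y - measurement u f = r
  rw [mulVec_sub, dotProduct_sub, sub_dotProduct, sub_dotProduct,
    dotProduct_mulVec_symm hW r (measurement u d), norm_add_sq_real, real_inner_self_eq_norm_sq]
  ring

variable [DecidableEq ι]

/-- The regularized Gram matrix `K̂`. -/
noncomputable def regGram (u : ι → H) (W : Matrix ι ι ℝ) : Matrix ι ι ℝ := gram ℝ u + W⁻¹

theorem regGram_posDef (u : ι → H) {W : Matrix ι ι ℝ} (hW : W.PosDef) : (regGram u W).PosDef :=
  hW.inv.posSemidef_add (posSemidef_gram (𝕜 := ℝ) u)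

/-- The minimizer of `energy u y W`. -/
noncomputable def center (u : ι → H) (y : ι → ℝ) (W : Matrix ι ι ℝ) : H :=
  synth u ((regGram u W)⁻¹ *ᵥ y)

theorem mulVec_residual (u : ι → H) (y : ι → ℝ) {W : Matrix ι ι ℝ} (hW : W.PosDef) :
    W *ᵥ (y - measurement u (center u y W)) = (regGram u W)⁻¹ *ᵥ y := by
  have hK := (isUnit_iff_isUnit_det _).1 (regGram_posDef u hW).isUnit
  have hW' := (isUnit_iff_isUnit_det _).1 hW.isUnit
  have h1 : y = regGram u W *ᵥ ((regGram u W)⁻¹ *ᵥ y) := by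
    rw [mulVec_mulVec, mul_nonsing_inv _ hK, one_mulVec]
  rw [center, measurement_synth]
  generalize (regGram u W)⁻¹ *ᵥ y = z at h1 ⊢
  rw [h1, regGram, add_mulVec, add_sub_cancel_left, mulVec_mulVec, mul_nonsing_inv _ hW',
    one_mulVec]

/-- Completing the square. -/
theorem energy_center_add (u : ι → H) (y : ι → ℝ) {W : Matrix ι ι ℝ} (hW : W.PosDef) (d : H) :
    energy u y W (center u y W + d) =
      y ⬝ᵥ ((regGram u W)⁻¹ *ᵥ y) + energyForm u W d d := by
  have hres := mulVec_residual u y hW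
  rw [energy_add u y hW.isHermitian, hres, center, inner_synth, ← center,
    dotProduct_comm (measurement u d), sub_self, energy, hres, ← real_inner_self_eq_norm_sq]
  nth_rw 1 [center]
  rw [inner_synth, sub_dotProduct, dotProduct_comm (measurement u _)]
  ring

/-- The Riesz representative of `⟨·, g⟩` for `energyForm u W`. -/
noncomputable def direction (u : ι → H) (W : Matrix ι ι ℝ) (g : H) : H :=
  g - center u (measurement u g) W

theorem energyForm_direction (u : ι → H) {W : Matrix ι ι ℝ} (hW : W.PosDef) (g d : H) :
    energyForm u W d (direction u W g) = inner ℝ d g := by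
  rw [energyForm, direction, measurement_sub, mulVec_residual u _ hW, inner_sub_right,
    real_inner_comm (center _ _ _) d, center, inner_synth, dotProduct_comm (measurement u d)]
  ring

/-- The posterior mean of `⟨g, ·⟩`. -/
noncomputable def mean (u : ι → H) (y : ι → ℝ) (W : Matrix ι ι ℝ) (g : H) : ℝ :=
  measurement u g ⬝ᵥ ((regGram u W)⁻¹ *ᵥ y)

/-- The posterior variance of `⟨g, ·⟩`. -/
noncomputable def var (u : ι → H) (W : Matrix ι ι ℝ) (g : H) : ℝ :=
  ‖g‖ ^ 2 - measurement u g ⬝ᵥ ((regGram u W)⁻¹ *ᵥ measurement u g)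

theorem inner_center (u : ι → H) (y : ι → ℝ) (W : Matrix ι ι ℝ) (g : H) :
    inner ℝ (center u y W) g = mean u y W g := by
  rw [center, inner_synth, dotProduct_comm, mean]

theorem var_eq_inner (u : ι → H) (W : Matrix ι ι ℝ) (g : H) :
    var u W g = inner ℝ (direction u W g) g := by
  rw [direction, inner_sub_left, inner_center, mean, var, real_inner_self_eq_norm_sq]

theorem var_eq_energyForm (u : ι → H) {W : Matrix ι ι ℝ} (hW : W.PosDef) (g : H) :
    var u W g = energyForm u W (direction u W g) (direction u W g) := by
  rw [energyForm_direction u hW, var_eq_inner]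

theorem var_nonneg (u : ι → H) {W : Matrix ι ι ℝ} (hW : W.PosDef) (g : H) : 0 ≤ var u W g := by
  rw [var_eq_energyForm u hW]
  exact (sq_nonneg _).trans (norm_sq_le_energyForm_self u hW.posSemidef _)

/-- The posterior variance of a nonzero functional is positive since the noise is not degenerate. -/
theorem var_pos (u : ι → H) {W : Matrix ι ι ℝ} (hW : W.PosDef) {g : H} (hg : g ≠ 0) :
    0 < var u W g := by
  refine lt_of_le_of_ne (var_nonneg u hW g) fun h0 => hg ?_
  rw [var_eq_energyForm u hW] at h0
  have h1 := norm_sq_le_energyForm_self u hW.posSemidef (direction u W g)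
  have h2 : direction u W g = 0 := by
    rw [← norm_eq_zero, ← sq_eq_zero_iff]
    exact le_antisymm (h1.trans h0.ge) (sq_nonneg _)
  have h3 := energyForm_direction u hW g g
  rw [h2] at h3
  rw [← inner_self_eq_zero (𝕜 := ℝ), ← h3]
  simp [energyForm, measurement_zero]

theorem le_energy (u : ι → H) (y : ι → ℝ) {W : Matrix ι ι ℝ} (hW : W.PosDef) (f : H) :
    y ⬝ᵥ ((regGram u W)⁻¹ *ᵥ y) ≤ energy u y W f := by
  have h := energy_center_add u y hW (f - center u y W)
  rw [add_sub_cancel] at h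
  have := norm_sq_le_energyForm_self u hW.posSemidef (f - center u y W)
  have := sq_nonneg ‖f - center u y W‖
  linarith

/-! ### The support function of one ellipsoid -/

/-- The Lagrangian `⟨g, f⟩ + ν (R - energy f)` is at most its value at its maximizer. -/
theorem lagrangian_le (u : ι → H) (y : ι → ℝ) {W : Matrix ι ι ℝ} (hW : W.PosDef) (g f : H)
    (R : ℝ) {ν : ℝ} (hν : 0 < ν) :
    inner ℝ g f + ν * (R - energy u y W f) ≤
      mean u y W g + ν * (R - y ⬝ᵥ ((regGram u W)⁻¹ *ᵥ y)) + var u W g / (4 * ν) := by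
  obtain ⟨d, rfl⟩ : ∃ d, f = center u y W + d := ⟨f - center u y W, by abel⟩
  have h1 := energyForm_sub_smul_self u hW.isHermitian d (direction u W g) (1 / (2 * ν))
  have h2 := (sq_nonneg _).trans
    (norm_sq_le_energyForm_self u hW.posSemidef (d - (1 / (2 * ν)) • direction u W g))
  rw [h1, energyForm_direction u hW g d, ← var_eq_energyForm u hW] at h2
  rw [energy_center_add u y hW, inner_add_right, real_inner_comm _ g, inner_center,
    real_inner_comm _ g]
  have h3 := mul_nonneg hν.le h2
  have h4 : ν * (energyForm u W d d - 2 * (1 / (2 * ν)) * inner ℝ d g +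
      (1 / (2 * ν)) ^ 2 * var u W g) =
      ν * energyForm u W d d - inner ℝ d g + var u W g / (4 * ν) := by
    field_simp
    ring
  rw [h4] at h3
  linarith

/-- Along the ray from the center in the maximizing direction, objective and energy are explicit. -/
theorem inner_center_add_smul_direction (u : ι → H) (y : ι → ℝ) (W : Matrix ι ι ℝ)
    (g : H) (t : ℝ) : inner ℝ g (center u y W + t • direction u W g) =
      mean u y W g + t * var u W g := by
  rw [real_inner_comm, inner_add_left, inner_center, inner_smul_left, ← var_eq_inner]
  simp

theorem energy_center_add_smul_direction (u : ι → H) (y : ι → ℝ) {W : Matrix ι ι ℝ}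
    (hW : W.PosDef) (g : H) (t : ℝ) : energy u y W (center u y W + t • direction u W g) =
      y ⬝ᵥ ((regGram u W)⁻¹ *ᵥ y) + t ^ 2 * var u W g := by
  rw [energy_center_add u y hW, var_eq_energyForm u hW]
  have := energyForm_sub_smul_self u hW.isHermitian 0 (direction u W g) (-t)
  simp only [neg_smul, sub_neg_eq_add, zero_add] at this
  rw [this]
  simp [energyForm, measurement_zero]

/-- The maximum of `⟨g, ·⟩` over the ellipsoid `energy u y W ≤ R`. -/
noncomputable def ellipsoidSup (u : ι → H) (y : ι → ℝ) (W : Matrix ι ι ℝ) (R : ℝ) (g : H) : ℝ :=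
  mean u y W g + √(R - y ⬝ᵥ ((regGram u W)⁻¹ *ᵥ y)) * √(var u W g)

/-- The multiplier attached to the energy constraint in the maximization over the ellipsoid. -/
noncomputable def multiplier (u : ι → H) (y : ι → ℝ) (W : Matrix ι ι ℝ) (R : ℝ) (g : H) : ℝ :=
  √(var u W g) / (2 * √(R - y ⬝ᵥ ((regGram u W)⁻¹ *ᵥ y)))

theorem lagrangian_le_ellipsoidSup (u : ι → H) (y : ι → ℝ) {W : Matrix ι ι ℝ} (hW : W.PosDef)
    {g : H} (hg : g ≠ 0) (f : H) {R : ℝ} (hR : y ⬝ᵥ ((regGram u W)⁻¹ *ᵥ y) < R) :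
    inner ℝ g f + multiplier u y W R g * (R - energy u y W f) ≤ ellipsoidSup u y W R g := by
  have hs := Real.sqrt_pos.2 (var_pos u hW hg)
  have hβ := Real.sqrt_pos.2 (sub_pos.2 hR)
  have hν : 0 < multiplier u y W R g := by unfold multiplier; positivity
  refine (lagrangian_le u y hW g f R hν).trans_eq ?_
  rw [ellipsoidSup, multiplier]
  have h1 := Real.sq_sqrt (var_nonneg u hW g)
  have h2 := Real.sq_sqrt (sub_pos.2 hR).le
  set s := √(var u W g)
  set β := √(R - y ⬝ᵥ ((regGram u W)⁻¹ *ᵥ y))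
  rw [← h1, ← h2]
  field_simp
  ring

/-- Every Lagrangian dual value bounds the maximum over the ellipsoid, by the inequality between
arithmetic and geometric means. -/
theorem ellipsoidSup_le (u : ι → H) (y : ι → ℝ) {W : Matrix ι ι ℝ} (hW : W.PosDef)
    {g : H} {R : ℝ} (hR : y ⬝ᵥ ((regGram u W)⁻¹ *ᵥ y) < R) {ν p : ℝ} (hν : 0 < ν)
    (hp : ∀ f, inner ℝ g f + ν * (R - energy u y W f) ≤ p) : ellipsoidSup u y W R g ≤ p := by
  refine le_trans ?_ (hp (center u y W + (1 / (2 * ν)) • direction u W g))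
  rw [inner_center_add_smul_direction, energy_center_add_smul_direction u y hW, ellipsoidSup]
  have h1 := Real.sq_sqrt (var_nonneg u hW g)
  have h2 := Real.sq_sqrt (sub_pos.2 hR).le
  set s := √(var u W g)
  set β := √(R - y ⬝ᵥ ((regGram u W)⁻¹ *ᵥ y))
  rw [← sub_sub, ← h1, ← h2]
  have h3 : mean u y W g + 1 / (2 * ν) * s ^ 2 + ν * (β ^ 2 - (1 / (2 * ν)) ^ 2 * s ^ 2)
      - (mean u y W g + β * s) = ν * (β - s / (2 * ν)) ^ 2 := by
    field_simp
    ring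
  have h4 : 0 ≤ ν * (β - s / (2 * ν)) ^ 2 := by positivity
  linarith

/-- The maximum over the ellipsoid is attained, on its boundary. -/
theorem exists_energy_eq_inner_eq_ellipsoidSup (u : ι → H) (y : ι → ℝ) {W : Matrix ι ι ℝ}
    (hW : W.PosDef) {g : H} (hg : g ≠ 0) {R : ℝ} (hR : y ⬝ᵥ ((regGram u W)⁻¹ *ᵥ y) < R) :
    ∃ f, energy u y W f = R ∧ inner ℝ g f = ellipsoidSup u y W R g := by
  refine ⟨center u y W + (√(R - y ⬝ᵥ ((regGram u W)⁻¹ *ᵥ y)) / √(var u W g)) •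
    direction u W g, ?_, ?_⟩
  · have hs := var_pos u hW hg
    rw [energy_center_add_smul_direction u y hW, div_pow, Real.sq_sqrt hs.le,
      Real.sq_sqrt (sub_pos.2 hR).le, div_mul_cancel₀ _ hs.ne', add_sub_cancel]
  · have hs := Real.sqrt_pos.2 (var_pos u hW hg)
    rw [inner_center_add_smul_direction, ellipsoidSup]
    nth_rw 2 [← Real.mul_self_sqrt (var_nonneg u hW g)]
    rw [← mul_assoc, div_mul_cancel₀ _ hs.ne']

theorem ellipsoidSup_zero (u : ι → H) (y : ι → ℝ) (W : Matrix ι ι ℝ) (R : ℝ) :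
    ellipsoidSup u y W R 0 = 0 := by
  simp [ellipsoidSup, mean, var, measurement_zero]

theorem le_ellipsoidSup (u : ι → H) (y : ι → ℝ) {W : Matrix ι ι ℝ} (hW : W.PosDef)
    (g f : H) {R : ℝ} (hR : y ⬝ᵥ ((regGram u W)⁻¹ *ᵥ y) < R) (hf : energy u y W f ≤ R) :
    inner ℝ g f ≤ ellipsoidSup u y W R g := by
  rcases eq_or_ne g 0 with rfl | hg
  · rw [ellipsoidSup_zero, inner_zero_left]
  · refine le_trans ?_ (lagrangian_le_ellipsoidSup u y hW hg f hR)
    have : 0 ≤ multiplier u y W R g := by unfold multiplier; positivity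
    nlinarith

end Regression

/-! ### The family of ellipsoids containing the feasible set -/

section WorstCase

variable {H : Type*} [NormedAddCommGroup H] [InnerProductSpace ℝ H] {N ncon : ℕ}

/-- The cost `w ↦ wᵀ P w` of the residual `w = y - measurement u f` of `f`. -/
noncomputable def residualCost (u : Fin N → H) (y : Fin N → ℝ) (P : Matrix (Fin N) (Fin N) ℝ)
    (f : H) : ℝ :=
  (y - measurement u f) ⬝ᵥ (P *ᵥ (y - measurement u f))

/-- The right-hand side of the constraint obtained by adding the norm constraint and the noise
constraints with weights `1` and `σ j ^ (-2)`. -/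
noncomputable def budget (Γf : ℝ) (Γw σ : Fin ncon → ℝ) : ℝ := Γf ^ 2 + ∑ j, Γw j ^ 2 / σ j ^ 2

/-- The worst-case bound of `⟨g, ·⟩` over the ellipsoid with weights `σ`. -/
noncomputable def relaxedBound (u : Fin N → H) (y : Fin N → ℝ)
    (P : Fin ncon → Matrix (Fin N) (Fin N) ℝ) (Γf : ℝ) (Γw : Fin ncon → ℝ) (g : H)
    (σ : Fin ncon → ℝ) : ℝ :=
  ellipsoidSup u y (noisePrecision P σ) (budget Γf Γw σ) g

theorem dotProduct_noisePrecision_mulVec (P : Fin ncon → Matrix (Fin N) (Fin N) ℝ)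
    (σ : Fin ncon → ℝ) (v : Fin N → ℝ) :
    v ⬝ᵥ (noisePrecision P σ *ᵥ v) = ∑ j, (σ j ^ 2)⁻¹ * (v ⬝ᵥ (P j *ᵥ v)) := by
  simp [noisePrecision, sum_mulVec, dotProduct_sum, smul_mulVec]

theorem noisePrecision_posDef {P : Fin ncon → Matrix (Fin N) (Fin N) ℝ}
    (hP : ∀ j, (P j).PosSemidef) (hPsum : (∑ j, P j).PosDef) {σ : Fin ncon → ℝ}
    (hσ : σ ∈ posOrthant ncon) : (noisePrecision P σ).PosDef := by
  have hσ' : ∀ j, 0 < (σ j ^ 2)⁻¹ := fun j => inv_pos.2 (pow_pos (hσ j) 2)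
  have hps : (noisePrecision P σ).PosSemidef :=
    posSemidef_sum _ fun j _ => (hP j).smul (hσ' j).le
  refine PosDef.of_dotProduct_mulVec_pos hps.isHermitian fun v hv => ?_
  have h1 := hPsum.dotProduct_mulVec_pos hv
  rw [star_trivial] at h1 ⊢
  rw [sum_mulVec, dotProduct_sum] at h1
  have hnn : ∀ j, 0 ≤ v ⬝ᵥ (P j *ᵥ v) := fun j => by
    simpa using (hP j).dotProduct_mulVec_nonneg v
  obtain ⟨j, -, hj⟩ := (Finset.sum_pos_iff_of_nonneg fun j _ => hnn j).1 h1
  rw [dotProduct_noisePrecision_mulVec]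
  exact Finset.sum_pos' (fun i _ => mul_nonneg (hσ' i).le (hnn i))
    ⟨j, Finset.mem_univ j, mul_pos (hσ' j) hj⟩

/-- The slack of `f` in the ellipsoid with weights `σ` is the weighted sum of its slacks. -/
theorem budget_sub_energy (u : Fin N → H) (y : Fin N → ℝ)
    (P : Fin ncon → Matrix (Fin N) (Fin N) ℝ) (Γf : ℝ) (Γw σ : Fin ncon → ℝ) (f : H) :
    budget Γf Γw σ - energy u y (noisePrecision P σ) f =
      (Γf ^ 2 - ‖f‖ ^ 2) + ∑ j, (Γw j ^ 2 - residualCost u y (P j) f) * (σ j ^ 2)⁻¹ := by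
  simp only [budget, energy, dotProduct_noisePrecision_mulVec, residualCost, sub_mul,
    Finset.sum_sub_distrib, div_eq_mul_inv]
  simp only [mul_comm (_⁻¹ : ℝ)]
  ring

variable {u : Fin N → H} {y : Fin N → ℝ} {P : Fin ncon → Matrix (Fin N) (Fin N) ℝ}
  {Γf : ℝ} {Γw σ : Fin ncon → ℝ}

/-- A strictly feasible point lies in the interior of every ellipsoid. -/
theorem lt_budget_of_strictly_feasible (hP : ∀ j, (P j).PosSemidef) (hPsum : (∑ j, P j).PosDef)
    {f₀ : H} (hf₀ : ‖f₀‖ ^ 2 < Γf ^ 2) (hw : ∀ j, residualCost u y (P j) f₀ < Γw j ^ 2)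
    (hσ : σ ∈ posOrthant ncon) :
    y ⬝ᵥ ((regGram u (noisePrecision P σ))⁻¹ *ᵥ y) < budget Γf Γw σ := by
  refine (le_energy u y (noisePrecision_posDef hP hPsum hσ) f₀).trans_lt ?_
  rw [← sub_pos, budget_sub_energy]
  have : 0 ≤ ∑ j, (Γw j ^ 2 - residualCost u y (P j) f₀) * (σ j ^ 2)⁻¹ :=
    Finset.sum_nonneg fun j _ => mul_nonneg (sub_pos.2 (hw j)).le (by positivity)
  linarith

theorem inner_le_relaxedBound (hP : ∀ j, (P j).PosSemidef) (hPsum : (∑ j, P j).PosDef)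
    (hσ : σ ∈ posOrthant ncon)
    (hR : y ⬝ᵥ ((regGram u (noisePrecision P σ))⁻¹ *ᵥ y) < budget Γf Γw σ) (g : H) {f : H}
    (hf : ‖f‖ ^ 2 ≤ Γf ^ 2) (hw : ∀ j, residualCost u y (P j) f ≤ Γw j ^ 2) :
    inner ℝ g f ≤ relaxedBound u y P Γf Γw g σ := by
  refine le_ellipsoidSup u y (noisePrecision_posDef hP hPsum hσ) g f hR ?_
  rw [← sub_nonneg, budget_sub_energy]
  have : 0 ≤ ∑ j, (Γw j ^ 2 - residualCost u y (P j) f) * (σ j ^ 2)⁻¹ :=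
    Finset.sum_nonneg fun j _ => mul_nonneg (sub_nonneg.2 (hw j)) (by positivity)
  linarith

/-! ### Strong duality -/

theorem convexOn_residualCost (u : Fin N → H) (y : Fin N → ℝ) {Q : Matrix (Fin N) (Fin N) ℝ}
    (hQ : Q.PosSemidef) : ConvexOn ℝ Set.univ (residualCost u y Q) := by
  refine ⟨convex_univ, fun f _ f' _ a b ha hb hab => ?_⟩
  have h1 : y - measurement u (a • f + b • f') =
      a • (y - measurement u f) + b • (y - measurement u f') := by
    rw [measurement_add, measurement_smul, measurement_smul, smul_sub, smul_sub]
    nth_rw 1 [← one_smul ℝ y, ← hab, add_smul]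
    abel
  have h2 := hQ.dotProduct_mulVec_nonneg ((y - measurement u f) - (y - measurement u f'))
  simp only [residualCost, h1, smul_eq_mul]
  generalize y - measurement u f = r at h2 ⊢
  generalize y - measurement u f' = s at h2 ⊢
  have h3 := dotProduct_mulVec_symm hQ.isHermitian r s
  obtain rfl : b = 1 - a := by linarith
  simp only [star_trivial, mulVec_sub, mulVec_add, mulVec_smul, dotProduct_sub, sub_dotProduct,
    dotProduct_add, add_dotProduct, dotProduct_smul, smul_dotProduct, smul_eq_mul] at h2 ⊢
  have h4 := mul_nonneg (mul_nonneg ha hb) h2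
  rw [h3] at h4 ⊢
  linarith

theorem convexOn_norm_sq : ConvexOn ℝ Set.univ fun f : H => ‖f‖ ^ 2 :=
  (convexOn_norm convex_univ).pow (fun f _ => norm_nonneg f) 2

/-- The ellipsoid bounds come arbitrarily close to the worst-case value. The optimal multipliers of
the worst-case problem may vanish, so they are shifted by a small `δ > 0` before they are turned
into weights `σ`. -/
theorem exists_relaxedBound_le (hP : ∀ j, (P j).PosSemidef) (hPsum : (∑ j, P j).PosDef)
    (hΓf : 0 < Γf) {f₀ : H} (hf₀ : ‖f₀‖ ^ 2 < Γf ^ 2)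
    (hw : ∀ j, residualCost u y (P j) f₀ < Γw j ^ 2) {g : H} {p : ℝ}
    (hp : ∀ f, ‖f‖ ^ 2 ≤ Γf ^ 2 → (∀ j, residualCost u y (P j) f ≤ Γw j ^ 2) → inner ℝ g f ≤ p)
    {ε : ℝ} (hε : 0 < ε) :
    ∃ σ ∈ posOrthant ncon, relaxedBound u y P Γf Γw g σ ≤ p + ε := by
  obtain ⟨m, hm, hL⟩ := exists_lagrange_multipliers (E := H) (ι := Option (Fin ncon))
    (φ := fun f => inner ℝ g f)
    (q := fun o f => o.elim (‖f‖ ^ 2 - Γf ^ 2) fun j => residualCost u y (P j) f - Γw j ^ 2)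
    ((innerₛₗ ℝ g).concaveOn convex_univ)
    (by
      rintro (_ | j)
      · exact convexOn_norm_sq.sub (concaveOn_const _ convex_univ)
      · exact (convexOn_residualCost u y (hP j)).sub (concaveOn_const _ convex_univ))
    (f₀ := f₀) (by
      rintro (_ | j)
      · exact sub_neg.2 hf₀
      · exact sub_neg.2 (hw j))
    (p := p) fun f hf => hp f (sub_nonpos.1 (hf none)) fun j => sub_nonpos.1 (hf (some j))
  simp only [Fintype.sum_option, Option.elim] at hL
  have hC : 0 < Γf ^ 2 + ∑ j, Γw j ^ 2 := by positivity
  set δ := ε / (Γf ^ 2 + ∑ j, Γw j ^ 2) with hδ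
  have hδ0 : 0 < δ := by positivity
  have hν : 0 < m none + δ := add_pos_of_nonneg_of_pos (hm _) hδ0
  have hl : ∀ j, 0 < m (some j) + δ := fun j => add_pos_of_nonneg_of_pos (hm _) hδ0
  set τ : Fin ncon → ℝ := fun j => √((m none + δ) / (m (some j) + δ)) with hτ
  have hτ0 : τ ∈ posOrthant ncon := fun j => Real.sqrt_pos.2 (div_pos hν (hl j))
  refine ⟨τ, hτ0, ellipsoidSup_le u y (noisePrecision_posDef hP hPsum hτ0)
    (lt_budget_of_strictly_feasible hP hPsum hf₀ hw hτ0) hν fun f => ?_⟩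
  have h1 : ∀ j, (m none + δ) * ((Γw j ^ 2 - residualCost u y (P j) f) * (τ j ^ 2)⁻¹) =
      (m (some j) + δ) * (Γw j ^ 2 - residualCost u y (P j) f) := by
    intro j
    rw [hτ, Real.sq_sqrt (div_pos hν (hl j)).le, inv_div]
    field_simp
  rw [budget_sub_energy, mul_add, Finset.mul_sum, Finset.sum_congr rfl fun j _ => h1 j]
  have h2 : ∑ j, (m (some j) + δ) * (Γw j ^ 2 - residualCost u y (P j) f) =
      -(∑ j, m (some j) * (residualCost u y (P j) f - Γw j ^ 2))
        + δ * ∑ j, Γw j ^ 2 - δ * ∑ j, residualCost u y (P j) f := by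
    rw [Finset.mul_sum, Finset.mul_sum, ← Finset.sum_neg_distrib, ← Finset.sum_add_distrib,
      ← Finset.sum_sub_distrib]
    exact Finset.sum_congr rfl fun j _ => by ring
  have h3 : 0 ≤ ∑ j, residualCost u y (P j) f := Finset.sum_nonneg fun j _ =>
    (hP j).dotProduct_mulVec_nonneg (y - measurement u f)
  have h4 := mul_nonneg hδ0.le h3
  have h5 := mul_nonneg hδ0.le (sq_nonneg ‖f‖)
  have h6 : δ * (Γf ^ 2 + ∑ j, Γw j ^ 2) = ε := div_mul_cancel₀ _ hC.ne'
  have h7 := hL f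
  rw [h2]
  linarith

/-! ### Differentiability and invexity in the weights -/

theorem differentiableAt_inv_sq (hσ : σ ∈ posOrthant ncon) (j : Fin ncon) :
    DifferentiableAt ℝ (fun z : Fin ncon → ℝ => (z j ^ 2)⁻¹) σ :=
  DifferentiableAt.inv (by fun_prop) (pow_pos (hσ j) 2).ne'

theorem differentiableAt_regGram_inv (hP : ∀ j, (P j).PosSemidef) (hPsum : (∑ j, P j).PosDef)
    (u : Fin N → H) (hσ : σ ∈ posOrthant ncon) (i k : Fin N) :
    DifferentiableAt ℝ (fun z => (regGram u (noisePrecision P z))⁻¹ i k) σ := by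
  have hW := noisePrecision_posDef hP hPsum hσ
  refine differentiableAt_matrix_inv (A := fun z => regGram u (noisePrecision P z))
    (fun i k => ?_) (regGram_posDef u hW).det_pos.ne' i k
  simp only [regGram, Matrix.add_apply]
  refine DifferentiableAt.fun_add (differentiableAt_const _) ?_
  refine differentiableAt_matrix_inv (A := noisePrecision P) (fun i k => ?_) hW.det_pos.ne' i k
  simp only [noisePrecision, Matrix.sum_apply, Matrix.smul_apply, smul_eq_mul]
  exact DifferentiableAt.fun_sum fun j _ => (differentiableAt_inv_sq hσ j).mul_const _

theorem differentiableAt_budget (hσ : σ ∈ posOrthant ncon) :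
    DifferentiableAt ℝ (budget Γf Γw) σ := by
  unfold budget
  simp only [div_eq_mul_inv]
  exact (differentiableAt_const _).add
    (DifferentiableAt.fun_sum fun j _ => (differentiableAt_inv_sq hσ j).const_mul _)

section

variable (hP : ∀ j, (P j).PosSemidef) (hPsum : (∑ j, P j).PosDef) (hσ : σ ∈ posOrthant ncon)
  (hR : y ⬝ᵥ ((regGram u (noisePrecision P σ))⁻¹ *ᵥ y) < budget Γf Γw σ)

include hP hPsum hσ

theorem differentiableAt_sqrt_var {g : H} (hg : g ≠ 0) :
    DifferentiableAt ℝ (fun z => √(var u (noisePrecision P z) g)) σ := by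
  refine DifferentiableAt.sqrt ?_ (var_pos u (noisePrecision_posDef hP hPsum hσ) hg).ne'
  exact (differentiableAt_const _).sub (differentiableAt_dotProduct_mulVec
    (differentiableAt_regGram_inv hP hPsum u hσ) _ _)

include hR

theorem differentiableAt_sqrt_budget_sub :
    DifferentiableAt ℝ
      (fun z => √(budget Γf Γw z - y ⬝ᵥ ((regGram u (noisePrecision P z))⁻¹ *ᵥ y))) σ := by
  refine DifferentiableAt.sqrt ?_ (sub_pos.2 hR).ne'
  exact (differentiableAt_budget hσ).sub (differentiableAt_dotProduct_mulVec
    (differentiableAt_regGram_inv hP hPsum u hσ) _ _)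

theorem differentiableAt_relaxedBound (g : H) :
    DifferentiableAt ℝ (relaxedBound u y P Γf Γw g) σ := by
  rcases eq_or_ne g 0 with rfl | hg
  · have : relaxedBound u y P Γf Γw 0 = fun _ => 0 := by
      funext z; exact ellipsoidSup_zero _ _ _ _
    rw [this]
    exact differentiableAt_const _
  · exact (differentiableAt_dotProduct_mulVec
      (differentiableAt_regGram_inv hP hPsum u hσ) _ _).add
      ((differentiableAt_sqrt_budget_sub hP hPsum hσ hR).mul
        (differentiableAt_sqrt_var hP hPsum hσ hg))

theorem differentiableAt_multiplier {g : H} (hg : g ≠ 0) :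
    DifferentiableAt ℝ
      (fun z => multiplier u y (noisePrecision P z) (budget Γf Γw z) g) σ := by
  simp only [multiplier, div_eq_mul_inv]
  exact (differentiableAt_sqrt_var hP hPsum hσ hg).mul
    (((differentiableAt_sqrt_budget_sub hP hPsum hσ hR).const_mul 2).inv
      (mul_pos two_pos (Real.sqrt_pos.2 (sub_pos.2 hR))).ne')

end

theorem isOpen_posOrthant : IsOpen (posOrthant ncon) := by
  simp only [posOrthant, Set.ofPred_forall]
  exact isOpen_iInter_of_finite fun j => isOpen_lt continuous_const (continuous_apply j)

/-- A stationary point of `c + ∑ a j σ j ^ (-2)` in the positive orthant has `a = 0`. -/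
theorem eq_zero_of_fderiv_sum_inv_sq_eq_zero (a : Fin ncon → ℝ) (c : ℝ)
    (hσ : σ ∈ posOrthant ncon)
    (h : fderiv ℝ (fun z : Fin ncon → ℝ => c + ∑ j, a j * (z j ^ 2)⁻¹) σ = 0) : a = 0 := by
  have h1 : ∀ j, HasFDerivAt (fun z : Fin ncon → ℝ => a j * (z j ^ 2)⁻¹)
      ((a j * (-(2 * σ j) / (σ j ^ 2) ^ 2)) • ContinuousLinearMap.proj (R := ℝ) j) σ := by
    intro j
    have h2 : HasDerivAt (fun t : ℝ => a j * (t ^ 2)⁻¹)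
        (a j * (-(2 * σ j) / (σ j ^ 2) ^ 2)) (σ j) := by
      simpa using ((hasDerivAt_pow 2 (σ j)).fun_inv (pow_pos (hσ j) 2).ne').const_mul (a j)
    exact HasDerivAt.comp_hasFDerivAt (h₂ := fun t : ℝ => a j * (t ^ 2)⁻¹) σ h2
      (hasFDerivAt_apply j σ)
  have h3 := ((HasFDerivAt.fun_sum (u := Finset.univ) fun j _ => h1 j).const_add c).fderiv
  rw [h] at h3
  ext j
  have h4 := congrArg (fun L : (Fin ncon → ℝ) →L[ℝ] ℝ => L (Pi.single j 1)) h3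
  have hj := hσ j
  simpa [Pi.single_apply, hj.ne'] using h4.symm

/-- At a stationary point `σ`, the maximizer over the ellipsoid is feasible: by the envelope
theorem, the partial derivatives of the bound are nonzero multiples of the slacks of the noise
constraints there. Hence the bound at `σ` is the worst-case value, and no `τ` gives less. -/
theorem relaxedBound_le_of_fderiv_eq_zero (hP : ∀ j, (P j).PosSemidef)
    (hPsum : (∑ j, P j).PosDef)
    (hR : ∀ σ ∈ posOrthant ncon,
      y ⬝ᵥ ((regGram u (noisePrecision P σ))⁻¹ *ᵥ y) < budget Γf Γw σ)
    (hσ : σ ∈ posOrthant ncon) (g : H) (h0 : fderiv ℝ (relaxedBound u y P Γf Γw g) σ = 0)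
    {τ : Fin ncon → ℝ} (hτ : τ ∈ posOrthant ncon) :
    relaxedBound u y P Γf Γw g σ ≤ relaxedBound u y P Γf Γw g τ := by
  rcases eq_or_ne g 0 with rfl | hg
  · simp [relaxedBound, ellipsoidSup_zero]
  obtain ⟨f, hf, hgf⟩ := exists_energy_eq_inner_eq_ellipsoidSup u y
    (noisePrecision_posDef hP hPsum hσ) hg (hR σ hσ)
  rw [← relaxedBound] at hgf
  set a : Fin ncon → ℝ := fun j => Γw j ^ 2 - residualCost u y (P j) f with ha
  set G : (Fin ncon → ℝ) → ℝ := fun z => (Γf ^ 2 - ‖f‖ ^ 2) + ∑ j, a j * (z j ^ 2)⁻¹ with hG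
  have hGσ : G σ = 0 := by
    rw [hG, ha]
    simp only
    rw [← budget_sub_energy, hf, sub_self]
  have hGd : DifferentiableAt ℝ G σ := (differentiableAt_const _).add
    (DifferentiableAt.fun_sum fun j _ => (differentiableAt_inv_sq hσ j).const_mul _)
  set ν := fun z => multiplier u y (noisePrecision P z) (budget Γf Γw z) g with hν
  have hνd : DifferentiableAt ℝ ν σ := differentiableAt_multiplier hP hPsum hσ (hR σ hσ) hg
  have hνσ : 0 < ν σ := by
    have := Real.sqrt_pos.2 (var_pos u (noisePrecision_posDef hP hPsum hσ) hg)
    have := Real.sqrt_pos.2 (sub_pos.2 (hR σ hσ))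
    simp only [hν, multiplier]
    positivity
  -- The Lagrangian at `f` is a lower bound of the relaxed bound that touches it at `σ`.
  have hmin : IsLocalMin (fun z => relaxedBound u y P Γf Γw g z - ν z * G z) σ := by
    filter_upwards [isOpen_posOrthant.mem_nhds hσ] with z hz
    have h1 := lagrangian_le_ellipsoidSup u y (noisePrecision_posDef hP hPsum hz) hg f (hR z hz)
    rw [budget_sub_energy, ← relaxedBound] at h1
    rw [hGσ, ← hgf]
    simp only [hν, hG, ha]
    linarith
  have hd := hmin.fderiv_eq_zero
  rw [fderiv_fun_sub (differentiableAt_relaxedBound hP hPsum hσ (hR σ hσ) g) (hνd.fun_mul hGd), h0,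
    fderiv_fun_mul hνd hGd, hGσ, zero_smul, add_zero, zero_sub, neg_eq_zero] at hd
  have ha0 := eq_zero_of_fderiv_sum_inv_sq_eq_zero a _ hσ
    ((smul_eq_zero.1 hd).resolve_left hνσ.ne')
  have hw : ∀ j, residualCost u y (P j) f ≤ Γw j ^ 2 := fun j =>
    (sub_eq_zero.1 (congrFun ha0 j)).ge
  have hnorm : ‖f‖ ^ 2 ≤ Γf ^ 2 := by
    have : G σ = Γf ^ 2 - ‖f‖ ^ 2 := by simp [hG, ha0]
    linarith
  rw [← hgf]
  exact inner_le_relaxedBound hP hPsum hτ (hR τ hτ) g hnorm hw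

end WorstCase

/-! ### The matrix formulas in terms of the reproducing kernel Hilbert space -/

section RKHS

variable {nx nf N ncon : ℕ}
  {H : Type*} [NormedAddCommGroup H] [InnerProductSpace ℝ H] [CompleteSpace H]
  [RKHS ℝ H (EuclideanSpace ℝ (Fin nx)) (EuclideanSpace ℝ (Fin nf))]
  {k : EuclideanSpace ℝ (Fin nx) → EuclideanSpace ℝ (Fin nx) → Matrix (Fin nf) (Fin nf) ℝ}

variable (H) in
/-- The representer of the functional `f ↦ aᵀ f(s)`. -/
noncomputable def representer (s : EuclideanSpace ℝ (Fin nx)) (a : Fin nf → ℝ) : H :=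
  RKHS.kerFun H s (WithLp.toLp 2 a)

theorem inner_representer (s : EuclideanSpace ℝ (Fin nx)) (a : Fin nf → ℝ) (f : H) :
    inner ℝ (representer H s a) f = a ⬝ᵥ (f s).ofLp := by
  rw [representer, RKHS.kerFun_inner, EuclideanSpace.inner_eq_star_dotProduct, star_trivial,
    dotProduct_comm]

theorem inner_representer_representer (hk : IsRKHSOf H k) (s t : EuclideanSpace ℝ (Fin nx))
    (a b : Fin nf → ℝ) :
    inner ℝ (representer H s a) (representer H t b) = a ⬝ᵥ (k s t *ᵥ b) := by
  rw [inner_representer, representer, RKHS.kerFun_apply, hk, Matrix.ofLp_toEuclideanCLM]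

theorem gramHat_eq (hk : IsRKHSOf H k) (x : Fin N → EuclideanSpace ℝ (Fin nx))
    (c : Fin N → Fin nf → ℝ) (P : Fin ncon → Matrix (Fin N) (Fin N) ℝ) (σ : Fin ncon → ℝ) :
    gramHat k x c P σ = regGram (fun i => representer H (x i) (c i)) (noisePrecision P σ) := by
  rw [gramHat, regGram]
  congr 1
  ext i j
  rw [gram_apply, inner_representer_representer hk]
  simp [Matrix.mul_apply, measMatrix, gramTrain, Fintype.sum_prod_type, dotProduct, mulVec,
    Finset.sum_mul, Finset.mul_sum]
  rw [Finset.sum_comm]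
  simp only [mul_assoc]

theorem vecMul_gramTestTrain_mul_measMatrix (hk : IsRKHSOf H k)
    (x : Fin N → EuclideanSpace ℝ (Fin nx)) (c : Fin N → Fin nf → ℝ) (h : Fin nf → ℝ)
    (xt : EuclideanSpace ℝ (Fin nx)) :
    h ᵥ* (gramTestTrain k x xt * measMatrix c) =
      measurement (fun i => representer H (x i) (c i)) (representer H xt h) := by
  ext j
  rw [measurement, real_inner_comm, inner_representer_representer hk]
  simp [Matrix.mul_apply, measMatrix, gramTestTrain, Fintype.sum_prod_type, dotProduct, mulVec,
    vecMul]

theorem transpose_measMatrix_mul_gramTrainTest_mulVec (hk : IsRKHSOf H k)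
    (x : Fin N → EuclideanSpace ℝ (Fin nx)) (c : Fin N → Fin nf → ℝ) (h : Fin nf → ℝ)
    (xt : EuclideanSpace ℝ (Fin nx)) :
    ((measMatrix c)ᵀ * gramTrainTest k x xt) *ᵥ h =
      measurement (fun i => representer H (x i) (c i)) (representer H xt h) := by
  ext j
  rw [measurement, inner_representer_representer hk]
  simp [Matrix.mul_apply, measMatrix, gramTrainTest, Fintype.sum_prod_type, dotProduct, mulVec]
  simp only [Finset.sum_mul, Finset.mul_sum, mul_assoc]
  exact Finset.sum_comm

theorem dotProduct_postMean (hk : IsRKHSOf H k) (x : Fin N → EuclideanSpace ℝ (Fin nx))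
    (c : Fin N → Fin nf → ℝ) (y : Fin N → ℝ) (P : Fin ncon → Matrix (Fin N) (Fin N) ℝ)
    (h : Fin nf → ℝ) (xt : EuclideanSpace ℝ (Fin nx)) (σ : Fin ncon → ℝ) :
    h ⬝ᵥ postMean k x c y P xt σ =
      mean (fun i => representer H (x i) (c i)) y (noisePrecision P σ) (representer H xt h) := by
  rw [postMean, mean, ← gramHat_eq hk, ← vecMul_gramTestTrain_mul_measMatrix hk, ← mulVec_mulVec,
    dotProduct_mulVec]

theorem dotProduct_postCov_mulVec (hk : IsRKHSOf H k) (x : Fin N → EuclideanSpace ℝ (Fin nx))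
    (c : Fin N → Fin nf → ℝ) (P : Fin ncon → Matrix (Fin N) (Fin N) ℝ)
    (h : Fin nf → ℝ) (xt : EuclideanSpace ℝ (Fin nx)) (σ : Fin ncon → ℝ) :
    h ⬝ᵥ (postCov k x c P xt σ *ᵥ h) =
      var (fun i => representer H (x i) (c i)) (noisePrecision P σ) (representer H xt h) := by
  rw [postCov, sub_mulVec, dotProduct_sub, var, ← real_inner_self_eq_norm_sq,
    inner_representer_representer hk, ← gramHat_eq hk, Matrix.mul_assoc _ (measMatrix c)ᵀ,
    ← mulVec_mulVec, transpose_measMatrix_mul_gramTrainTest_mulVec hk, ← mulVec_mulVec,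
    dotProduct_mulVec h (gramTestTrain _ _ _ * _), vecMul_gramTestTrain_mul_measMatrix hk]

theorem betaSq_eq (hk : IsRKHSOf H k) (x : Fin N → EuclideanSpace ℝ (Fin nx))
    (c : Fin N → Fin nf → ℝ) (y : Fin N → ℝ) (P : Fin ncon → Matrix (Fin N) (Fin N) ℝ)
    (Γf : ℝ) (Γw σ : Fin ncon → ℝ) :
    betaSq k x c y P Γf Γw σ = budget Γf Γw σ -
      y ⬝ᵥ ((regGram (fun i => representer H (x i) (c i)) (noisePrecision P σ))⁻¹ *ᵥ y) := by
  rw [betaSq, gramHat_eq hk, budget]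

theorem gpBound_eq (hk : IsRKHSOf H k) (x : Fin N → EuclideanSpace ℝ (Fin nx))
    (c : Fin N → Fin nf → ℝ) (y : Fin N → ℝ) (P : Fin ncon → Matrix (Fin N) (Fin N) ℝ)
    (Γf : ℝ) (Γw : Fin ncon → ℝ) (h : Fin nf → ℝ) (xt : EuclideanSpace ℝ (Fin nx)) :
    gpBound k x c y P Γf Γw h xt =
      relaxedBound (fun i => representer H (x i) (c i)) y P Γf Γw (representer H xt h) := by
  funext σ
  rw [gpBound, relaxedBound, ellipsoidSup, dotProduct_postMean hk, dotProduct_postCov_mulVec hk,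
    betaSq_eq hk]

/-- The noise is determined by the function, so the worst-case problem is one over `f` alone. -/
theorem mem_feasibleValues_iff {x : Fin N → EuclideanSpace ℝ (Fin nx)}
    {c : Fin N → Fin nf → ℝ} {y : Fin N → ℝ} {P : Fin ncon → Matrix (Fin N) (Fin N) ℝ}
    {Γf : ℝ} {Γw : Fin ncon → ℝ} {h : Fin nf → ℝ} {xt : EuclideanSpace ℝ (Fin nx)} {v : ℝ} :
    v ∈ feasibleValues H x c y P Γf Γw h xt ↔ ∃ f : H, ‖f‖ ^ 2 ≤ Γf ^ 2 ∧
      (∀ j, residualCost (fun i => representer H (x i) (c i)) y (P j) f ≤ Γw j ^ 2) ∧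
      inner ℝ (representer H xt h) f = v := by
  constructor
  · rintro ⟨f, w, hy, hw, hf, rfl⟩
    have : y - measurement (fun i => representer H (x i) (c i)) f = w := by
      ext i
      simp [measurement, inner_representer, ← hy i]
    exact ⟨f, hf, fun j => by rw [residualCost, this]; exact hw j, inner_representer xt h f⟩
  · rintro ⟨f, hf, hw, rfl⟩
    refine ⟨f, y - measurement (fun i => representer H (x i) (c i)) f, fun i => ?_, hw, hf,
      inner_representer xt h f⟩
    simp [measurement, inner_representer]

end RKHS

end KernelBound

theorem theorem1 {nx nf N ncon : ℕ}
    (k : EuclideanSpace ℝ (Fin nx) → EuclideanSpace ℝ (Fin nx) → Matrix (Fin nf) (Fin nf) ℝ)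
    {H : Type*} [NormedAddCommGroup H] [InnerProductSpace ℝ H] [CompleteSpace H]
    [RKHS ℝ H (EuclideanSpace ℝ (Fin nx)) (EuclideanSpace ℝ (Fin nf))]
    (hk : KernelBound.IsRKHSOf H k)
    -- the data
    (x : Fin N → EuclideanSpace ℝ (Fin nx)) (c : Fin N → Fin nf → ℝ) (y w : Fin N → ℝ)
    (ftr : H) (hy : ∀ i, y i = c i ⬝ᵥ (ftr (x i)).ofLp + w i)
    -- the noise lies in an intersection of ellipsoids
    (P : Fin ncon → Matrix (Fin N) (Fin N) ℝ) (Γw : Fin ncon → ℝ)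
    (hP : ∀ j, (P j).PosSemidef) (hPsum : (∑ j, P j).PosDef) (hΓw : ∀ j, 0 < Γw j)
    (hw : ∀ j, w ⬝ᵥ (P j *ᵥ w) < Γw j ^ 2)
    -- the true function has bounded norm
    (Γf : ℝ) (hΓf : 0 < Γf) (hf : ‖ftr‖ < Γf)
    (h : Fin nf → ℝ) (xt : EuclideanSpace ℝ (Fin nx)) :
    -- all inverses and square roots in the bound are meaningful
    (∀ σ ∈ KernelBound.posOrthant ncon,
      (KernelBound.noisePrecision P σ).PosDef ∧ (KernelBound.gramHat k x c P σ).PosDef ∧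
      0 ≤ KernelBound.betaSq k x c y P Γf Γw σ ∧
      0 ≤ h ⬝ᵥ (KernelBound.postCov k x c P xt σ *ᵥ h)) ∧
    -- (i)
    (∀ σ ∈ KernelBound.posOrthant ncon,
      h ⬝ᵥ (ftr xt).ofLp ≤ KernelBound.gpBound k x c y P Γf Γw h xt σ) ∧
    -- (ii)
    (IsLUB (KernelBound.feasibleValues H x c y P Γf Γw h xt)
        (KernelBound.optimalBound H x c y P Γf Γw h xt) ∧
      IsGLB (KernelBound.gpBound k x c y P Γf Γw h xt '' KernelBound.posOrthant ncon)
        (KernelBound.optimalBound H x c y P Γf Γw h xt)) ∧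
    -- (iii)
    (∀ σ ∈ KernelBound.posOrthant ncon,
      DifferentiableAt ℝ (KernelBound.gpBound k x c y P Γf Γw h xt) σ ∧
      (IsMinOn (KernelBound.gpBound k x c y P Γf Γw h xt) (KernelBound.posOrthant ncon) σ ↔
        fderiv ℝ (KernelBound.gpBound k x c y P Γf Γw h xt) σ = 0)) := by
  open KernelBound in
  have hf₀ : ‖ftr‖ ^ 2 < Γf ^ 2 := pow_lt_pow_left₀ hf (norm_nonneg _) two_ne_zero
  have hw₀ : ∀ j,
      residualCost (fun i => representer H (x i) (c i)) y (P j) ftr < Γw j ^ 2 := by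
    have : y - measurement (fun i => representer H (x i) (c i)) ftr = w := by
      ext i
      simp [measurement, inner_representer, hy i]
    intro j
    rw [residualCost, this]
    exact hw j
  have hR : ∀ σ ∈ posOrthant ncon, y ⬝ᵥ ((regGram (fun i => representer H (x i) (c i))
      (noisePrecision P σ))⁻¹ *ᵥ y) < budget Γf Γw σ := fun σ hσ =>
    lt_budget_of_strictly_feasible hP hPsum hf₀ hw₀ hσ
  have hle : ∀ σ ∈ posOrthant ncon, ∀ v ∈ feasibleValues H x c y P Γf Γw h xt,
      v ≤ gpBound k x c y P Γf Γw h xt σ := by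
    intro σ hσ v hv
    obtain ⟨f, hf, hw, rfl⟩ := mem_feasibleValues_iff.1 hv
    rw [gpBound_eq hk]
    exact inner_le_relaxedBound hP hPsum hσ (hR σ hσ) _ hf hw
  have hmem : h ⬝ᵥ (ftr xt).ofLp ∈ feasibleValues H x c y P Γf Γw h xt :=
    mem_feasibleValues_iff.2 ⟨ftr, hf₀.le, fun j => (hw₀ j).le, inner_representer xt h ftr⟩
  have hlub : IsLUB (feasibleValues H x c y P Γf Γw h xt)
      (optimalBound H x c y P Γf Γw h xt) :=
    isLUB_csSup ⟨_, hmem⟩ ⟨_, hle (fun _ => 1) fun _ => one_pos⟩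
  refine ⟨fun σ hσ => ⟨noisePrecision_posDef hP hPsum hσ, ?_, ?_, ?_⟩,
    fun σ hσ => hle σ hσ _ hmem, ⟨hlub, ?_, fun b hb => ?_⟩, fun σ hσ => ⟨?_, ?_, ?_⟩⟩
  · rw [gramHat_eq hk]
    exact regGram_posDef _ (noisePrecision_posDef hP hPsum hσ)
  · rw [betaSq_eq hk]
    exact (sub_pos.2 (hR σ hσ)).le
  · rw [dotProduct_postCov_mulVec hk]
    exact var_nonneg _ (noisePrecision_posDef hP hPsum hσ) _
  · rintro _ ⟨σ, hσ, rfl⟩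
    exact hlub.2 (hle σ hσ)
  · refine le_of_forall_pos_le_add fun ε hε => ?_
    obtain ⟨σ, hσ, h1⟩ := exists_relaxedBound_le hP hPsum hΓf hf₀ hw₀
      (g := representer H xt h) (p := optimalBound H x c y P Γf Γw h xt)
      (fun f hf hw => hlub.1 (mem_feasibleValues_iff.2 ⟨f, hf, hw, rfl⟩)) hε
    refine le_trans (hb ⟨σ, hσ, rfl⟩) ?_
    rwa [gpBound_eq hk]
  · rw [gpBound_eq hk]
    exact differentiableAt_relaxedBound hP hPsum hσ (hR σ hσ) _
  · exact fun hmin => (hmin.isLocalMin (isOpen_posOrthant.mem_nhds hσ)).fderiv_eq_zero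
  · rw [gpBound_eq hk]
    exact fun h0 τ hτ => relaxedBound_le_of_fderiv_eq_zero hP hPsum hR hσ _ h0 hτ
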